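/- Let $H\in(0,\tfrac12)$, $x_0>0$, $a>0$, $\sigma>0$, and let $B^H=(B^H(t))_{t\ge 0}$ be a fractional Brownian motion with Hurst index $H$, i.e. a centred Gaussian process with covariance $\tfrac12\left(s^{2H}+t^{2H}-|t-s|^{2H}\right)$, with almost surely continuous paths. For $\varepsilon>0$ let $X^H_\varepsilon$ be the unique continuous (pathwise) solution of \[ X^H_\varepsilon(t)=x_0+\int_0^t\frac{a}{X^H_\varepsilon(s)\mathbf 1_{\{X^H_\varepsilon(s)>0\}}+\varepsilon}\,ds+\sigma B^H(t),\qquad t\ge 0, \] and let $X^H(t):=\lim_{\varepsilon\downarrow 0}X^H_\varepsilon(t)$, $t\ge 0$, be the rough Bessel process. Define the drift estimator, which depends only on the observed path of $X^H$ on $[0,T]$ (and not on $H$ or $\sigma$), by \[ \widehat a(T):=\frac{X^H(T)}{\int_0^T\frac{1}{X^H(t)}\,dt},\qquad T>0. \] Theorem (strong consistency of $\widehat a(T)$). With probability 1, the limit $X^H(t)$ exists and is finite for all $t\ge 0$, $X^H(t)>0$ for Lebesgue-almost every $t\ge 0$, $0<\int_0^T\frac{1}{X^H(t)}\,dt<\infty$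 for all $T>0$ (so that $\widehat a(T)$ is well defined), and \[ \widehat a(T)\to a,\qquad T\to\infty. \] -/

import Mathlib

open MeasureTheory ProbabilityTheory Filter Topology Set
open scoped NNReal

namespace RoughBessel

/-- Fractional Brownian motion with Hurst index `H` on the time axis `[0, ∞)`: a centred Gaussian
process with covariance `(s ^ (2H) + t ^ (2H) - |t - s| ^ (2H)) / 2`, in a version
whose paths are almost surely continuous. -/
structure IsFractionalBrownianMotion {Ω : Type*} [MeasurableSpace Ω]
    (H : ℝ) (B : ℝ≥0 → Ω → ℝ) (P : Measure Ω) : Prop where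
  isGaussianProcess : IsGaussianProcess B P
  integral_eq_zero : ∀ t, ∫ ω, B t ω ∂P = 0
  covariance_eq : ∀ s t, cov[B s, B t; P] =
    ((s : ℝ) ^ (2 * H) + (t : ℝ) ^ (2 * H) - |(t : ℝ) - (s : ℝ)| ^ (2 * H)) / 2
  continuous_paths : ∀ᵐ ω ∂P, Continuous fun t => B t ω

/-- The regularised drift `x ↦ a / (x 𝟙_{x > 0} + ε)`. -/
noncomputable def regDrift (a ε x : ℝ) : ℝ := a / ((if 0 < x then x else 0) + ε)

/-- The path `x` is a continuous solution of
`x(t) = x₀ + ∫₀ᵗ a / (x(s) 𝟙_{x(s) > 0} + ε) ds + σ b(t)`, `t ≥ 0`, driven by the path `b`. -/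
structure IsPrelimitPath (x₀ a σ ε : ℝ) (b x : ℝ≥0 → ℝ) : Prop where
  continuous_path : Continuous x
  integral_eq : ∀ t : ℝ≥0,
    x t = x₀ + (∫ s in (0 : ℝ)..t, regDrift a ε (x s.toNNReal)) + σ * b t

/-- The solution `X_ε` of the regularised equation driven by the path `b`.
For `a, ε > 0` and continuous `b` it exists and is unique:
see `existsUnique_isPrelimitPath` and `isPrelimitPath_prelimit`. -/
noncomputable def prelimit (x₀ a σ ε : ℝ) (b : ℝ≥0 → ℝ) : ℝ≥0 → ℝ :=
  Classical.epsilon (IsPrelimitPath x₀ a σ ε b)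

/-- The path of the rough Bessel process driven by the path `b`: the pointwise limit
of the solutions `X_ε` of the regularised equations as `ε ↓ 0`. -/
noncomputable def roughBessel (x₀ a σ : ℝ) (b : ℝ≥0 → ℝ) (t : ℝ≥0) : ℝ :=
  limUnder (𝓝[>] (0 : ℝ)) fun ε => prelimit x₀ a σ ε b t

/-- The drift estimator `x(T) / ∫₀ᵀ dt / x(t)`, a functional of the observed path `x` alone. -/
noncomputable def driftEstimator (x : ℝ≥0 → ℝ) (T : ℝ≥0) : ℝ :=
  x T / ∫ t in (0 : ℝ)..T, 1 / x t.toNNReal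

/-! ### Well-posedness of the regularised equation -/

lemma regDrift_eq (a ε x : ℝ) : regDrift a ε x = a / (max x 0 + ε) := by
  unfold regDrift
  split_ifs with h
  · rw [max_eq_left h.le]
  · rw [max_eq_right (not_lt.mp h)]

lemma continuous_regDrift {a ε : ℝ} (hε : 0 < ε) : Continuous (regDrift a ε) := by
  have : regDrift a ε = fun x => a / (max x 0 + ε) := funext (regDrift_eq a ε)
  rw [this]
  refine Continuous.div (by fun_prop) (by fun_prop) fun x => ?_
  have := le_max_right x 0
  positivity

lemma abs_regDrift_le {a ε : ℝ} (ha : 0 < a) (hε : 0 < ε) (x : ℝ) :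
    |regDrift a ε x| ≤ a / ε := by
  have h0 := le_max_right x 0
  rw [regDrift_eq, abs_of_nonneg (by positivity)]
  gcongr
  linarith

lemma abs_regDrift_sub_le {a ε : ℝ} (ha : 0 < a) (hε : 0 < ε) (x y : ℝ) :
    |regDrift a ε x - regDrift a ε y| ≤ a / (ε * ε) * |x - y| := by
  have hx := le_max_right x 0
  have hy := le_max_right y 0
  have hxy : |max y 0 - max x 0| ≤ |x - y| := by
    rw [abs_sub_comm x y]
    exact abs_max_sub_max_le_abs y x 0
  rw [regDrift_eq, regDrift_eq,
    show a / (max x 0 + ε) - a / (max y 0 + ε)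
      = a / ((max x 0 + ε) * (max y 0 + ε)) * (max y 0 - max x 0) by field_simp; ring,
    abs_mul, abs_of_nonneg (by positivity : 0 ≤ a / ((max x 0 + ε) * (max y 0 + ε)))]
  gcongr <;> linarith

/-- The right-hand side of the ordinary differential equation solved by `X_ε - σ b`. -/
noncomputable def shiftedDrift (a σ ε : ℝ) (b : ℝ≥0 → ℝ) (t y : ℝ) : ℝ :=
  regDrift a ε (y + σ * b t.toNNReal)

lemma lipschitzWith_shiftedDrift {a ε : ℝ} (σ : ℝ) (ha : 0 < a) (hε : 0 < ε) (b : ℝ≥0 → ℝ)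
    (t : ℝ) : LipschitzWith (a / (ε * ε)).toNNReal (shiftedDrift a σ ε b t) := by
  refine LipschitzWith.of_dist_le_mul fun x y => ?_
  rw [Real.coe_toNNReal _ (by positivity), Real.dist_eq, Real.dist_eq]
  refine (abs_regDrift_sub_le ha hε _ _).trans (le_of_eq ?_)
  congr 2
  ring

lemma shiftedDrift_unique {a ε : ℝ} (σ : ℝ) (ha : 0 < a) (hε : 0 < ε) (b : ℝ≥0 → ℝ) {T : ℝ}
    {f g : ℝ → ℝ}
    (hf : ∀ t ∈ Icc 0 T, HasDerivWithinAt f (shiftedDrift a σ ε b t (f t)) (Icc 0 T) t)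
    (hg : ∀ t ∈ Icc 0 T, HasDerivWithinAt g (shiftedDrift a σ ε b t (g t)) (Icc 0 T) t)
    (h0 : f 0 = g 0) : EqOn f g (Icc 0 T) := by
  have key : ∀ {f : ℝ → ℝ},
      (∀ t ∈ Icc 0 T, HasDerivWithinAt f (shiftedDrift a σ ε b t (f t)) (Icc 0 T) t) →
      ∀ t ∈ Ico 0 T, HasDerivWithinAt f (shiftedDrift a σ ε b t (f t)) (Ici t) t :=
    fun hf t ht => (hf t ⟨ht.1, ht.2.le⟩).mono_of_mem_nhdsWithin
      (mem_of_superset (Icc_mem_nhdsGE ht.2) (Icc_subset_Icc_left ht.1))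
  exact ODE_solution_unique (v := shiftedDrift a σ ε b)
    (lipschitzWith_shiftedDrift σ ha hε b)
    (fun t ht => (hf t ht).continuousWithinAt) (key hf)
    (fun t ht => (hg t ht).continuousWithinAt) (key hg) h0

lemma IsPrelimitPath.hasDerivWithinAt {x₀ a σ ε : ℝ} {b x : ℝ≥0 → ℝ} (hε : 0 < ε)
    (hx : IsPrelimitPath x₀ a σ ε b x) (T : ℝ) : ∀ t ∈ Icc 0 T,
      HasDerivWithinAt (fun t : ℝ => x t.toNNReal - σ * b t.toNNReal)
        (shiftedDrift a σ ε b t (x t.toNNReal - σ * b t.toNNReal)) (Icc 0 T) t := by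
  intro t ht
  have hc : Continuous fun s : ℝ => regDrift a ε (x s.toNNReal) :=
    (continuous_regDrift hε).comp (hx.continuous_path.comp continuous_real_toNNReal)
  have hd := (hc.integral_hasStrictDerivAt 0 t).hasDerivAt.const_add x₀
  have heq : ∀ s ∈ Icc 0 T, x s.toNNReal - σ * b s.toNNReal
      = x₀ + ∫ r in (0 : ℝ)..s, regDrift a ε (x r.toNNReal) := by
    intro s hs
    rw [hx.integral_eq, Real.coe_toNNReal _ hs.1]
    ring
  have := hd.hasDerivWithinAt (s := Icc 0 T) |>.congr heq (heq t ht)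
  simpa [shiftedDrift] using this

lemma exists_shiftedDrift {a ε : ℝ} (x₀ σ : ℝ) (ha : 0 < a) (hε : 0 < ε) {b : ℝ≥0 → ℝ}
    (hb : Continuous b) (n : ℕ) : ∃ f : ℝ → ℝ, f 0 = x₀ ∧ ∀ t ∈ Icc (0 : ℝ) n,
      HasDerivWithinAt f (shiftedDrift a σ ε b t (f t)) (Icc (0 : ℝ) n) t := by
  have hpl : IsPicardLindelof (shiftedDrift a σ ε b) (tmin := 0) (tmax := (n : ℝ))
      ⟨0, le_rfl, n.cast_nonneg⟩ x₀ ((a / ε).toNNReal * n) 0 (a / ε).toNNReal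
      (a / (ε * ε)).toNNReal := by
    refine ⟨fun t _ => (lipschitzWith_shiftedDrift σ ha hε b t).lipschitzOnWith,
      fun y _ => Continuous.continuousOn ?_, fun t _ y _ => ?_, ?_⟩
    · exact (continuous_regDrift hε).comp
        (continuous_const.add (continuous_const.mul (hb.comp continuous_real_toNNReal)))
    · rw [Real.norm_eq_abs, Real.coe_toNNReal _ (by positivity)]
      exact abs_regDrift_le ha hε _
    · simp
  exact hpl.exists_eq_forall_mem_Icc_hasDerivWithinAt₀

/-- For every `ε > 0` the regularised equation has exactly one solution. -/
theorem existsUnique_isPrelimitPath {a ε : ℝ} (x₀ σ : ℝ) (ha : 0 < a) (hε : 0 < ε)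
    {b : ℝ≥0 → ℝ} (hb : Continuous b) : ∃! x, IsPrelimitPath x₀ a σ ε b x := by
  choose f hf0 hf using exists_shiftedDrift x₀ σ ha hε hb
  have hagree : ∀ n m : ℕ, n ≤ m → EqOn (f n) (f m) (Icc (0 : ℝ) n) := fun n m hnm =>
    shiftedDrift_unique σ ha hε b (hf n)
      (fun t ht => (hf m t ⟨ht.1, ht.2.trans (by exact_mod_cast hnm)⟩).mono
        (Icc_subset_Icc_right (by exact_mod_cast hnm))) (by rw [hf0, hf0])
  have hz : ∀ (N : ℕ) (t : ℝ≥0), t ≤ N → f ⌈t⌉₊ t = f N t := fun N t ht =>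
    hagree _ _ (Nat.ceil_le.mpr ht) ⟨t.coe_nonneg, by exact_mod_cast Nat.le_ceil t⟩
  have hcont : ∀ N : ℕ, ContinuousOn (f N) (Icc (0 : ℝ) N) :=
    fun N t ht => (hf N t ht).continuousWithinAt
  refine ⟨fun t => f ⌈t⌉₊ t + σ * b t, ⟨?_, fun t => ?_⟩, fun y hy => ?_⟩
  · refine Continuous.add ?_ (continuous_const.mul hb)
    rw [continuous_iff_continuousAt]
    intro t
    obtain ⟨N, hN⟩ := exists_nat_gt t
    have h1 : ContinuousOn (fun s : ℝ≥0 => f N s) (Iic (N : ℝ≥0)) :=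
      (hcont N).comp NNReal.continuous_coe.continuousOn
        fun s hs => ⟨s.coe_nonneg, by exact_mod_cast hs⟩
    have hnhds : Iic (N : ℝ≥0) ∈ 𝓝 t := Iic_mem_nhds hN
    refine (h1.continuousAt hnhds).congr ?_
    filter_upwards [hnhds] with s hs using (hz N s hs).symm
  · obtain ⟨N, hN⟩ := exists_nat_gt t
    have hN' : (t : ℝ) ≤ N := by exact_mod_cast hN.le
    have hcg : (∫ s in (0 : ℝ)..t, regDrift a ε
          (f ⌈s.toNNReal⌉₊ s.toNNReal + σ * b s.toNNReal))
        = ∫ s in (0 : ℝ)..t, shiftedDrift a σ ε b s (f N s) := by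
      refine intervalIntegral.integral_congr fun s hs => ?_
      rw [uIcc_of_le t.coe_nonneg] at hs
      have hsN : s.toNNReal ≤ N := by
        rw [Real.toNNReal_le_iff_le_coe]
        simpa using hs.2.trans hN'
      simp only [shiftedDrift]
      rw [hz N _ hsN, Real.coe_toNNReal _ hs.1]
    have hvc : ContinuousOn (fun s => shiftedDrift a σ ε b s (f N s)) (Icc 0 (t : ℝ)) :=
      (continuous_regDrift hε).comp_continuousOn
        (((hcont N).mono (Icc_subset_Icc_right hN')).add
          (continuous_const.mul (hb.comp continuous_real_toNNReal)).continuousOn)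
    have hftc := intervalIntegral.integral_eq_sub_of_hasDeriv_right_of_le
      (f := f N) (f' := fun s => shiftedDrift a σ ε b s (f N s)) t.coe_nonneg
      ((hcont N).mono (Icc_subset_Icc_right hN'))
      (fun s hs => ((hf N s ⟨hs.1.le, hs.2.le.trans hN'⟩).mono_of_mem_nhdsWithin
        (mem_of_superset (Icc_mem_nhdsGT (hs.2.trans_le hN')) (Icc_subset_Icc_left hs.1.le))))
      (hvc.intervalIntegrable_of_Icc t.coe_nonneg)
    rw [hcg, hftc, hf0, hz N t hN.le]
    ring
  · funext t
    obtain ⟨N, hN⟩ := exists_nat_gt t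
    have h := shiftedDrift_unique σ ha hε b (hy.hasDerivWithinAt hε N) (hf N)
      (by simp [hf0, hy.integral_eq 0])
      (show (t : ℝ) ∈ Icc (0 : ℝ) N from ⟨t.coe_nonneg, by exact_mod_cast hN.le⟩)
    simp only [Real.toNNReal_coe] at h
    rw [hz N t hN.le, ← h]
    ring

/-- `prelimit` is the solution of the regularised equation. -/
theorem isPrelimitPath_prelimit {a ε : ℝ} (x₀ σ : ℝ) (ha : 0 < a) (hε : 0 < ε)
    {b : ℝ≥0 → ℝ} (hb : Continuous b) :
    IsPrelimitPath x₀ a σ ε b (prelimit x₀ a σ ε b) :=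
  Classical.epsilon_spec (existsUnique_isPrelimitPath x₀ σ ha hε hb).exists

end RoughBessel

/-!
The drift `a / x` alone makes a path grow like `√(2 a t)`, while the driving path satisfies
`|B(t)| ≤ C (t + 1) ^ γ` for some `γ < 1 / 2`, because `H < 1 / 2`. The noise is therefore
negligible at infinity, and the rest of the argument is pathwise.

* Growth of the noise (`IsFractionalBrownianMotion.ae_growth`). A weighted sum of the `2q`-th powers
  of all dyadic increments, and of the values at integer times, has finite expectation and so is
  almost surely finite. Chaining along dyadic times then gives `γ = H + 1 / q` by continuity.
* The limit (`tendsto_prelimit`). The solutions `X_ε` decrease in `ε`, by a comparison after the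
  last time at which two of them agree, and they are bounded locally uniformly in `ε`. Hence they
  converge as `ε ↓ 0`. The integrals of the drifts are bounded as well, and Fatou's lemma yields
  that the limit `X` is positive almost everywhere and that `1 / X` is locally integrable.
* Bounds. Comparison with a suitable level, again after a last crossing, shows `X(t) ≤ K √(t + 1)`
  (`exists_roughBessel_le_mul_sqrt`) and that `X₁`, hence every `X_ε` with `ε ≤ 1`, is at least `1`
  after some time `T₀` (`eventually_one_le_prelimit`).
* Conclusion (`tendsto_driftEstimator_roughBessel`). The limit may fail to satisfy the singular
  equation near its zeros, but after `T₀` dominated convergence applies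
  (`roughBessel_eq_add_integral`), so `X(T) = D + a ∫₀ᵀ dt / X(t) + σ B(T)` for `T ≥ T₀` with `D`
  independent of `T`. The upper bound on `X` makes the integral at least of order `√T`, so
  that dividing by it leaves `a + o(1)`.
-/

namespace RoughBessel

/-! ### Growth of fractional Brownian motion -/

lemma ae_exists_forall_le_of_summable_integral {Ω ι : Type*} [MeasurableSpace Ω] [Countable ι]
    {P : Measure Ω} {f : ι → Ω → ℝ} (hf : ∀ i, Integrable (f i) P) (hf0 : ∀ i ω, 0 ≤ f i ω)
    (hs : Summable fun i => ∫ ω, f i ω ∂P) : ∀ᵐ ω ∂P, ∃ S : ℝ, 0 ≤ S ∧ ∀ i, f i ω ≤ S := by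
  have hm : ∀ i, AEMeasurable (fun ω => ENNReal.ofReal (f i ω)) P :=
    fun i => (hf i).aestronglyMeasurable.aemeasurable.ennreal_ofReal
  have hfin : ∫⁻ ω, ∑' i, ENNReal.ofReal (f i ω) ∂P ≠ ⊤ := by
    rw [lintegral_tsum hm]
    have : ∀ i, ∫⁻ ω, ENNReal.ofReal (f i ω) ∂P = ENNReal.ofReal (∫ ω, f i ω ∂P) := fun i =>
      (ofReal_integral_eq_lintegral_ofReal (hf i) (Eventually.of_forall (hf0 i))).symm
    simp_rw [this]
    exact hs.tsum_ofReal_ne_top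
  filter_upwards [ae_lt_top' (AEMeasurable.tsum hm) hfin] with ω hω
  refine ⟨(∑' i, ENNReal.ofReal (f i ω)).toReal, ENNReal.toReal_nonneg, fun i => ?_⟩
  rw [← ENNReal.ofReal_le_iff_le_toReal hω.ne]
  exact ENNReal.le_tsum (f := fun i => ENNReal.ofReal (f i ω)) i

/-- The even moments of a centred Gaussian variable are the powers of its variance, up to the
moment of the standard normal law. -/
lemma integral_pow_of_hasGaussianLaw {Ω : Type*} [MeasurableSpace Ω] {P : Measure Ω}
    {Z : Ω → ℝ} (hZ : HasGaussianLaw Z P) (h0 : ∫ ω, Z ω ∂P = 0) (q : ℕ) :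
    ∫ ω, Z ω ^ (2 * q) ∂P = Var[Z; P] ^ q * ∫ x, x ^ (2 * q) ∂gaussianReal 0 1 := by
  have h1 : P.map Z = (gaussianReal 0 1).map (√Var[Z; P] * ·) := by
    rw [hZ.map_eq_gaussianReal, gaussianReal_map_const_mul, h0]
    congr 1
    · simp
    · ext; simp [Real.sq_sqrt (variance_nonneg Z P)]
  calc ∫ ω, Z ω ^ (2 * q) ∂P = ∫ x, x ^ (2 * q) ∂(P.map Z) := by
        rw [integral_map hZ.aemeasurable (by fun_prop)]
    _ = ∫ x, (√Var[Z; P] * x) ^ (2 * q) ∂gaussianReal 0 1 := by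
        rw [h1, integral_map (by fun_prop) (by fun_prop)]
    _ = _ := by
        rw [← integral_const_mul]
        congr with x
        rw [mul_pow, pow_mul, Real.sq_sqrt (variance_nonneg Z P)]

lemma integrable_pow_of_hasGaussianLaw {Ω : Type*} [MeasurableSpace Ω] {P : Measure Ω}
    {Z : Ω → ℝ} (hZ : HasGaussianLaw Z P) (q : ℕ) : Integrable (fun ω => Z ω ^ q) P := by
  have := hZ.isProbabilityMeasure
  refine (integrable_norm_iff (hZ.aemeasurable.pow_const q).aestronglyMeasurable).1 ?_
  simpa using (hZ.memLp (p := q) (by simp)).integrable_norm_pow'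

namespace IsFractionalBrownianMotion

variable {Ω : Type*} [MeasurableSpace Ω] {H : ℝ} {B : ℝ≥0 → Ω → ℝ} {P : Measure Ω}

lemma variance_eq (hB : IsFractionalBrownianMotion H B P) (hH : 0 < H) (t : ℝ≥0) :
    Var[B t; P] = (t : ℝ) ^ (2 * H) := by
  rw [← covariance_self (hB.isGaussianProcess.aemeasurable t), hB.covariance_eq]
  simp [Real.zero_rpow (by positivity : 2 * H ≠ 0)]

lemma variance_sub_eq (hB : IsFractionalBrownianMotion H B P) (hH : 0 < H) (s t : ℝ≥0) :
    Var[B s - B t; P] = |(t : ℝ) - s| ^ (2 * H) := by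
  have := hB.isGaussianProcess.isProbabilityMeasure
  rw [variance_sub (hB.isGaussianProcess.hasGaussianLaw_eval s).memLp_two
    (hB.isGaussianProcess.hasGaussianLaw_eval t).memLp_two, hB.variance_eq hH, hB.variance_eq hH,
    hB.covariance_eq]
  ring

lemma integral_pow_eq (hB : IsFractionalBrownianMotion H B P) (hH : 0 < H) (q : ℕ) (t : ℝ≥0) :
    ∫ ω, B t ω ^ (2 * q) ∂P
      = ((t : ℝ) ^ (2 * H)) ^ q * ∫ x, x ^ (2 * q) ∂gaussianReal 0 1 := by
  rw [integral_pow_of_hasGaussianLaw (hB.isGaussianProcess.hasGaussianLaw_eval t)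
    (hB.integral_eq_zero t), hB.variance_eq hH]

lemma integral_sub_pow_eq (hB : IsFractionalBrownianMotion H B P) (hH : 0 < H) (q : ℕ)
    (s t : ℝ≥0) : ∫ ω, (B s ω - B t ω) ^ (2 * q) ∂P
      = (|(t : ℝ) - s| ^ (2 * H)) ^ q * ∫ x, x ^ (2 * q) ∂gaussianReal 0 1 := by
  have h := integral_pow_of_hasGaussianLaw (Z := B s - B t)
    hB.isGaussianProcess.hasGaussianLaw_sub ?_ q
  · simpa [hB.variance_sub_eq hH] using h
  · simp only [Pi.sub_apply]
    rw [integral_sub (hB.isGaussianProcess.hasGaussianLaw_eval s).integrable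
      (hB.isGaussianProcess.hasGaussianLaw_eval t).integrable, hB.integral_eq_zero,
      hB.integral_eq_zero, sub_zero]

/-- Almost surely, all increments over dyadic intervals are simultaneously controlled, since the
sum of the suitably weighted `2q`-th powers of them has finite expectation. -/
lemma ae_dyadic_increments_le (hB : IsFractionalBrownianMotion H B P) (hH : 0 < H) {q : ℕ}
    (hq : 0 < q) : ∀ᵐ ω ∂P, ∃ S : ℝ, 0 ≤ S ∧ ∀ k m : ℕ,
      (B (((m + 1 : ℕ) : ℝ≥0) / 2 ^ k) ω - B ((m : ℝ≥0) / 2 ^ k) ω) ^ (2 * q)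
        ≤ S * ((m + 1) ^ 2 * ((2 : ℝ) ^ (-(q * H))) ^ k) := by
  set r : ℝ := (2 : ℝ) ^ (-(q * H)) with hr
  have hr0 : 0 < r := by positivity
  have hr1 : r < 1 := Real.rpow_lt_one_of_one_lt_of_neg one_lt_two (by simp; positivity)
  set w : ℕ × ℕ → ℝ := fun i => ((i.2 + 1 : ℝ) ^ 2 * r ^ i.1) with hw
  have hw0 : ∀ i, 0 < w i := fun i => by positivity
  have h := ae_exists_forall_le_of_summable_integral (P := P) (ι := ℕ × ℕ)
    (f := fun i ω => (B (((i.2 + 1 : ℕ) : ℝ≥0) / 2 ^ i.1) ω - B ((i.2 : ℝ≥0) / 2 ^ i.1) ω)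
      ^ (2 * q) / w i)
    (fun i => (integrable_pow_of_hasGaussianLaw
      hB.isGaussianProcess.hasGaussianLaw_fun_sub (2 * q)).div_const _)
    (fun i ω => div_nonneg ((even_two_mul q).pow_nonneg _) (hw0 i).le) ?_
  · filter_upwards [h] with ω ⟨S, hS0, hS⟩
    exact ⟨S, hS0, fun k m => (div_le_iff₀ (hw0 (k, m))).1 (hS (k, m))⟩
  · have hv : ∀ i : ℕ × ℕ, (|(((i.2 : ℝ≥0) / 2 ^ i.1 : ℝ≥0) : ℝ)
        - ((((i.2 + 1 : ℕ) : ℝ≥0) / 2 ^ i.1 : ℝ≥0) : ℝ)| ^ (2 * H)) ^ q = r ^ i.1 * r ^ i.1 := by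
      intro i
      have : |(((i.2 : ℝ≥0) / 2 ^ i.1 : ℝ≥0) : ℝ)
          - ((((i.2 + 1 : ℕ) : ℝ≥0) / 2 ^ i.1 : ℝ≥0) : ℝ)| = (2 : ℝ) ^ (-(i.1 : ℝ)) := by
        push_cast
        rw [← sub_div, abs_div, Real.rpow_neg zero_le_two, Real.rpow_natCast]
        simp
      rw [this, ← Real.rpow_mul zero_le_two, ← Real.rpow_natCast, ← Real.rpow_mul zero_le_two, hr,
        ← pow_add, ← Real.rpow_natCast, ← Real.rpow_mul zero_le_two]
      congr 1
      push_cast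
      ring
    have hc : ∀ i : ℕ × ℕ, ∫ ω, (B (((i.2 + 1 : ℕ) : ℝ≥0) / 2 ^ i.1) ω
          - B ((i.2 : ℝ≥0) / 2 ^ i.1) ω) ^ (2 * q) / w i ∂P
        = (r ^ i.1 * (1 / ((i.2 + 1 : ℕ) : ℝ) ^ 2)) * ∫ x, x ^ (2 * q) ∂gaussianReal 0 1 := by
      intro i
      rw [integral_div, hB.integral_sub_pow_eq hH, hv, hw]
      have := pow_pos hr0 i.1
      push_cast
      field_simp
    simp_rw [hc]
    refine Summable.mul_right _ ?_
    exact Summable.mul_of_nonneg (f := fun k => r ^ k) (g := fun m => 1 / ((m + 1 : ℕ) : ℝ) ^ 2)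
      (summable_geometric_of_lt_one hr0.le hr1)
      ((summable_nat_add_iff 1).2 (Real.summable_one_div_nat_pow.2 one_lt_two))
      (fun k => by positivity) (fun m => by positivity)

/-- Almost surely, `|B(n)|` is at most a constant times `(n + 1) ^ (H + 1 / q)`, stated
for `2q`-th powers. -/
lemma ae_integer_times_le (hB : IsFractionalBrownianMotion H B P) (hH : 0 < H) (q : ℕ) :
    ∀ᵐ ω ∂P, ∃ S : ℝ, 0 ≤ S ∧ ∀ n : ℕ,
      B n ω ^ (2 * q) ≤ S * ((n + 1) ^ 2 * (((n : ℝ) + 1) ^ (2 * H)) ^ q) := by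
  set w : ℕ → ℝ := fun n => ((n + 1) ^ 2 * (((n : ℝ) + 1) ^ (2 * H)) ^ q) with hw
  have hw0 : ∀ i, 0 < w i := fun i => by positivity
  have h := ae_exists_forall_le_of_summable_integral (P := P)
    (f := fun (n : ℕ) ω => B n ω ^ (2 * q) / w n)
    (fun n => (integrable_pow_of_hasGaussianLaw
      (hB.isGaussianProcess.hasGaussianLaw_eval _) (2 * q)).div_const _)
    (fun i ω => div_nonneg ((even_two_mul q).pow_nonneg _) (hw0 i).le) ?_
  · filter_upwards [h] with ω ⟨S, hS0, hS⟩
    exact ⟨S, hS0, fun n => (div_le_iff₀ (hw0 n)).1 (hS n)⟩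
  · have hm : 0 ≤ ∫ x, x ^ (2 * q) ∂gaussianReal 0 1 :=
      integral_nonneg fun x => (even_two_mul q).pow_nonneg _
    refine Summable.of_nonneg_of_le
      (fun n => integral_nonneg fun ω => div_nonneg ((even_two_mul q).pow_nonneg _) (hw0 n).le)
      (fun n => ?_)
      (((summable_nat_add_iff 1).2 (Real.summable_one_div_nat_pow.2 one_lt_two)).mul_right
        (∫ x, x ^ (2 * q) ∂gaussianReal 0 1))
    rw [integral_div, hB.integral_pow_eq hH, mul_div_right_comm]
    refine mul_le_mul_of_nonneg_right ?_ hm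
    rw [div_le_div_iff₀ (hw0 n) (by positivity), hw]
    push_cast
    rw [one_mul, mul_comm]
    gcongr
    simp

end IsFractionalBrownianMotion

/-- Chaining along the dyadic approximations of `t` from below, which start at `⌊t⌋`. -/
lemma abs_sub_floor_le_of_dyadic {b : ℝ≥0 → ℝ} (hb : Continuous b) {A ρ : ℝ} (hA : 0 ≤ A)
    (hρ0 : 0 ≤ ρ) (hρ1 : ρ < 1) (t : ℝ≥0)
    (h : ∀ k m : ℕ, (m : ℝ) + 1 ≤ 2 ^ k * (t + 1) →
      |b (((m + 1 : ℕ) : ℝ≥0) / 2 ^ k) - b ((m : ℝ≥0) / 2 ^ k)| ≤ A * ρ ^ k) :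
    |b t - b ⌊t⌋₊| ≤ A / (1 - ρ) := by
  set u : ℕ → ℝ≥0 := fun k => (⌊2 ^ k * t⌋₊ : ℝ≥0) / 2 ^ k with hu
  have hu0 : u 0 = ⌊t⌋₊ := by simp [hu]
  have hstep : ∀ k, |b (u (k + 1)) - b (u k)| ≤ A * ρ ^ k := by
    intro k
    have hk : 0 ≤ A * ρ ^ k := by positivity
    have h1 : (⌊2 ^ k * t⌋₊ : ℝ≥0) ≤ 2 ^ k * t := Nat.floor_le (by positivity)
    have h2 : 2 ^ k * t < ⌊2 ^ k * t⌋₊ + 1 := Nat.lt_floor_add_one _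
    set m := ⌊2 ^ k * t⌋₊ with hm
    have hum : u k = ((2 * m : ℕ) : ℝ≥0) / 2 ^ (k + 1) := by
      simp only [hu, ← hm]
      rw [pow_succ]
      push_cast
      field_simp
    have h3 : 2 * m ≤ ⌊2 ^ (k + 1) * t⌋₊ := by
      rw [Nat.le_floor_iff (by positivity), pow_succ]
      push_cast
      linarith
    have h4 : ⌊2 ^ (k + 1) * t⌋₊ < 2 * m + 2 := by
      rw [Nat.floor_lt (by positivity), pow_succ]
      push_cast
      linarith
    rcases (by omega : ⌊2 ^ (k + 1) * t⌋₊ = 2 * m ∨ ⌊2 ^ (k + 1) * t⌋₊ = 2 * m + 1) with h5 | h5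
    · have : u (k + 1) = u k := by
        rw [hum]; simp only [hu]; rw [h5]
      simpa [this] using hk
    · have : u (k + 1) = ((2 * m + 1 : ℕ) : ℝ≥0) / 2 ^ (k + 1) := by
        simp only [hu]; rw [h5]
      rw [this, hum]
      refine (h (k + 1) (2 * m) ?_).trans ?_
      · have h6 : (m : ℝ) ≤ 2 ^ k * t := by exact_mod_cast h1
        have h7 : (1 : ℝ) ≤ 2 ^ k := one_le_pow₀ one_le_two
        rw [pow_succ]
        push_cast
        nlinarith
      · exact mul_le_mul_of_nonneg_left (pow_le_pow_of_le_one hρ0 hρ1.le k.le_succ) hA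
  have hsum : ∀ k, |b (u k) - b ⌊t⌋₊| ≤ A / (1 - ρ) := by
    intro k
    have h1 : |b (u k) - b (u 0)| ≤ ∑ i ∈ Finset.range k, A * ρ ^ i := by
      rw [← Finset.sum_range_sub (fun k => b (u k))]
      exact (Finset.abs_sum_le_sum_abs _ _).trans (Finset.sum_le_sum fun i _ => hstep i)
    rw [← hu0, div_eq_mul_inv]
    refine h1.trans ?_
    rw [← Finset.mul_sum, ← tsum_geometric_of_lt_one hρ0 hρ1]
    gcongr
    exact (summable_geometric_of_lt_one hρ0 hρ1).sum_le_tsum _ fun i _ => by positivity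
  have hlim : Tendsto u atTop (𝓝 t) := by
    have h0 : Tendsto (fun k : ℕ => (t : ℝ) - (1 / 2) ^ k) atTop (𝓝 t) := by
      simpa using (tendsto_pow_atTop_nhds_zero_of_lt_one (r := (1 / 2 : ℝ)) (by norm_num)
        (by norm_num)).const_sub (t : ℝ)
    rw [← NNReal.tendsto_coe]
    refine tendsto_of_tendsto_of_tendsto_of_le_of_le h0 tendsto_const_nhds (fun k => ?_)
      fun k => ?_
    · have h1 : 2 ^ k * (t : ℝ) < ⌊2 ^ k * t⌋₊ + 1 := by
        exact_mod_cast Nat.lt_floor_add_one (2 ^ k * t)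
      simp only [hu, NNReal.coe_div, NNReal.coe_natCast, NNReal.coe_pow, NNReal.coe_ofNat]
      rw [le_div_iff₀ (by positivity), sub_mul, ← mul_pow]
      norm_num
      linarith
    · have h1 : (⌊2 ^ k * t⌋₊ : ℝ) ≤ 2 ^ k * t := by
        exact_mod_cast Nat.floor_le (2 ^ k * t).2
      simp only [hu, NNReal.coe_div, NNReal.coe_natCast, NNReal.coe_pow, NNReal.coe_ofNat]
      rw [div_le_iff₀ (by positivity)]
      linarith
  exact le_of_tendsto (((hb.tendsto t).comp hlim).sub_const _).abs (Eventually.of_forall hsum)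

/-- Fractional Brownian motion grows more slowly than `t ^ γ` for every `γ > H`; the exponent
obtained from the moments of order `2q` is `H + 1 / q`. -/
lemma IsFractionalBrownianMotion.ae_growth {Ω : Type*} [MeasurableSpace Ω] {H : ℝ}
    {B : ℝ≥0 → Ω → ℝ} {P : Measure Ω} (hB : IsFractionalBrownianMotion H B P) (hH : 0 < H) {q : ℕ}
    (hq : 3 ≤ q * H) : ∀ᵐ ω ∂P, ∃ C : ℝ, ∀ t : ℝ≥0, |B t ω| ≤ C * ((t : ℝ) + 1) ^ (H + 1 / q) := by
  have hq0 : 0 < q := by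
    rcases Nat.eq_zero_or_pos q with rfl | h
    · norm_num at hq
    · exact h
  have hq0' : (0 : ℝ) < q := by exact_mod_cast hq0
  have hqne : 2 * q ≠ 0 := by omega
  filter_upwards [hB.continuous_paths, hB.ae_dyadic_increments_le hH hq0,
    hB.ae_integer_times_le hH q] with ω hc ⟨S, hS0, hS⟩ ⟨R, hR0, hR⟩
  have root : ∀ x : ℝ, 0 ≤ x → (x ^ (1 / (2 * q : ℕ) : ℝ)) ^ (2 * q) = x := fun x hx => by
    rw [one_div]
    exact Real.rpow_inv_natCast_pow hx hqne
  set ρ : ℝ := (1 / 2 : ℝ) ^ (1 / (2 * q : ℕ) : ℝ) with hρ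
  have hρ0 : 0 < ρ := by positivity
  have hρ1 : ρ < 1 := Real.rpow_lt_one (by norm_num) (by norm_num) (by positivity)
  set C₁ : ℝ := S ^ (1 / (2 * q : ℕ) : ℝ)
  set C₂ : ℝ := R ^ (1 / (2 * q : ℕ) : ℝ)
  have hC₁ : 0 ≤ C₁ := by positivity
  have hC₂ : 0 ≤ C₂ := by positivity
  refine ⟨C₁ / (1 - ρ) + C₂, fun t => ?_⟩
  set v : ℝ := ((t : ℝ) + 1) ^ (1 / (2 * q : ℕ) : ℝ) with hv
  have hv0 : 0 < v := by positivity
  have hv2 : v ^ 2 = ((t : ℝ) + 1) ^ (1 / q : ℝ) := by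
    rw [hv, ← Real.rpow_natCast, ← Real.rpow_mul (by positivity)]
    congr 1
    push_cast
    field_simp
  have ht1 : (1 : ℝ) ≤ t + 1 := by simp
  have h1 : |B t ω - B ⌊t⌋₊ ω| ≤ C₁ * v ^ 2 / (1 - ρ) := by
    refine abs_sub_floor_le_of_dyadic hc (by positivity) hρ0.le hρ1 t fun k m hm => ?_
    refine (pow_le_pow_iff_left₀ (abs_nonneg _) (by positivity) hqne).1 ?_
    rw [(even_two_mul q).pow_abs]
    refine (hS k m).trans ?_
    -- The weight `(m + 1) ^ 2` costs a factor `4 ^ k` on the grid of mesh `2 ^ (-k)`, which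
    -- `3 ≤ q * H` compensates.
    have hr : (2 : ℝ) ^ (-(q * H)) ≤ 1 / 8 :=
      calc (2 : ℝ) ^ (-(q * H)) ≤ 2 ^ (-3 : ℝ) :=
            Real.rpow_le_rpow_of_exponent_le one_le_two (by linarith)
        _ = 1 / 8 := by rw [Real.rpow_neg zero_le_two]; norm_num
    calc S * (((m : ℝ) + 1) ^ 2 * ((2 : ℝ) ^ (-(q * H))) ^ k)
        ≤ S * ((2 ^ k * ((t : ℝ) + 1)) ^ 2 * (1 / 8) ^ k) := by gcongr
      _ = S * ((t + 1) ^ 2 * (1 / 2) ^ k) := by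
          have : ((1 : ℝ) / 2) ^ k = (2 ^ k) ^ 2 * (1 / 8) ^ k := by
            rw [← pow_mul, mul_comm k 2, pow_mul, ← mul_pow]; norm_num
          rw [this]; ring
      _ = (C₁ * v ^ 2 * ρ ^ k) ^ (2 * q) := by
          rw [mul_pow, mul_pow, root S hS0, pow_right_comm v, pow_right_comm ρ,
            root _ (by positivity), root _ (by positivity)]
          ring
  have h2 : |B ⌊t⌋₊ ω| ≤ C₂ * ((t : ℝ) + 1) ^ (H + 1 / q) := by
    refine (pow_le_pow_iff_left₀ (abs_nonneg _) (by positivity) hqne).1 ?_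
    rw [(even_two_mul q).pow_abs]
    refine (hR _).trans ?_
    have hfl : ((⌊t⌋₊ : ℝ≥0) : ℝ) ≤ t := by exact_mod_cast Nat.floor_le t.2
    simp only [NNReal.coe_natCast] at hfl
    calc R * (((⌊t⌋₊ : ℝ) + 1) ^ 2 * (((⌊t⌋₊ : ℝ) + 1) ^ (2 * H)) ^ q)
        ≤ R * (((t : ℝ) + 1) ^ 2 * (((t : ℝ) + 1) ^ (2 * H)) ^ q) := by gcongr
      _ = (C₂ * ((t : ℝ) + 1) ^ (H + 1 / q)) ^ (2 * q) := by
          rw [mul_pow, root R hR0, ← Real.rpow_natCast _ q, ← Real.rpow_natCast _ (2 * q),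
            ← Real.rpow_natCast _ 2,
            ← Real.rpow_mul (by positivity), ← Real.rpow_mul (by positivity),
            ← Real.rpow_add (by positivity)]
          congr 2
          push_cast
          field_simp
          ring
  have h3 : v ^ 2 ≤ ((t : ℝ) + 1) ^ (H + 1 / q) := by
    rw [hv2]
    exact Real.rpow_le_rpow_of_exponent_le ht1 (by linarith)
  calc |B t ω| = |(B t ω - B ⌊t⌋₊ ω) + B ⌊t⌋₊ ω| := by ring_nf
    _ ≤ C₁ * v ^ 2 / (1 - ρ) + C₂ * ((t : ℝ) + 1) ^ (H + 1 / q) :=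
        (abs_add_le _ _).trans (add_le_add h1 h2)
    _ = C₁ / (1 - ρ) * v ^ 2 + C₂ * ((t : ℝ) + 1) ^ (H + 1 / q) := by ring
    _ ≤ C₁ / (1 - ρ) * ((t : ℝ) + 1) ^ (H + 1 / q) + C₂ * ((t : ℝ) + 1) ^ (H + 1 / q) := by
        have : 0 ≤ C₁ / (1 - ρ) := div_nonneg hC₁ (by linarith)
        gcongr
    _ = _ := by ring

/-! ### Bounds for the regularised equation -/

/-- A continuous function that has fallen below a level stays below it after a last crossing. -/
lemma exists_last_crossing {f : ℝ≥0 → ℝ} (hf : Continuous f) {c : ℝ} {r t : ℝ≥0} (hrt : r ≤ t)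
    (hr : c ≤ f r) (ht : f t < c) : ∃ s, s < t ∧ f s = c ∧ ∀ u, s < u → u ≤ t → f u < c := by
  have hK : IsCompact (Icc r t ∩ {u | c ≤ f u}) :=
    isCompact_Icc.inter_right (isClosed_le continuous_const hf)
  obtain ⟨s, ⟨hs, hcs⟩, hmax⟩ := hK.exists_isGreatest ⟨r, ⟨le_rfl, hrt⟩, hr⟩
  have hlast : ∀ u, s < u → u ≤ t → f u < c := fun u hsu hut => by
    by_contra! h
    exact (hmax ⟨⟨hs.1.trans hsu.le, hut⟩, h⟩).not_gt hsu
  obtain ⟨u, hu, hfu⟩ := intermediate_value_Icc' hs.2 hf.continuousOn ⟨ht.le, hcs⟩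
  have hus : u = s := le_antisymm (hmax ⟨⟨hs.1.trans hu.1, hu.2⟩, hfu.ge⟩) hu.1
  exact ⟨s, lt_of_le_of_ne hs.2 (by rintro rfl; exact ht.not_ge hcs), hus ▸ hfu, hlast⟩

lemma regDrift_nonneg {a ε : ℝ} (ha : 0 < a) (hε : 0 < ε) (x : ℝ) : 0 ≤ regDrift a ε x := by
  rw [regDrift_eq]
  have := le_max_right x 0
  positivity

lemma regDrift_le_regDrift {a ε₁ ε₂ x y : ℝ} (ha : 0 < a) (hε₁ : 0 < ε₁) (hε : ε₁ ≤ ε₂)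
    (hxy : x ≤ y) : regDrift a ε₂ y ≤ regDrift a ε₁ x := by
  rw [regDrift_eq, regDrift_eq]
  have := le_max_right x 0
  gcongr

namespace IsPrelimitPath

variable {x₀ a σ ε : ℝ} {b x : ℝ≥0 → ℝ}

lemma continuous_drift (hx : IsPrelimitPath x₀ a σ ε b x) (hε : 0 < ε) :
    Continuous fun r : ℝ => regDrift a ε (x r.toNNReal) :=
  (continuous_regDrift hε).comp (hx.continuous_path.comp continuous_real_toNNReal)

lemma apply_zero (hx : IsPrelimitPath x₀ a σ ε b x) : x 0 = x₀ + σ * b 0 := by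
  simp [hx.integral_eq 0]

lemma eq_add_integral (hx : IsPrelimitPath x₀ a σ ε b x) (hε : 0 < ε) (s t : ℝ≥0) :
    x t = x s + (∫ r in (s : ℝ)..t, regDrift a ε (x r.toNNReal)) + σ * (b t - b s) := by
  have hi := fun u v : ℝ => (hx.continuous_drift hε).intervalIntegrable (μ := volume) u v
  rw [hx.integral_eq t, hx.integral_eq s,
    ← intervalIntegral.integral_add_adjacent_intervals (hi 0 s) (hi s t)]
  ring

/-- The solution decreases with `ε`: after the last time at which the two paths
agree the difference of the drifts would have the wrong sign. -/
lemma le_of_le {ε₁ ε₂ : ℝ} {x₁ x₂ : ℝ≥0 → ℝ} (hx₁ : IsPrelimitPath x₀ a σ ε₁ b x₁)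
    (hx₂ : IsPrelimitPath x₀ a σ ε₂ b x₂) (ha : 0 < a) (hε₁ : 0 < ε₁) (hε : ε₁ ≤ ε₂) (t : ℝ≥0) :
    x₂ t ≤ x₁ t := by
  have hε₂ := hε₁.trans_le hε
  by_contra! h
  obtain ⟨s, hst, hs, hlast⟩ := exists_last_crossing (f := fun t => x₁ t - x₂ t) (c := 0) (r := 0)
    (hx₁.continuous_path.sub hx₂.continuous_path) t.2
    (by simp [hx₁.apply_zero, hx₂.apply_zero]) (sub_neg.2 h)
  have hmono : ∫ r in (s : ℝ)..t, regDrift a ε₂ (x₂ r.toNNReal)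
      ≤ ∫ r in (s : ℝ)..t, regDrift a ε₁ (x₁ r.toNNReal) := by
    refine intervalIntegral.integral_mono_on_of_le_Ioo (by exact_mod_cast hst.le)
      ((hx₂.continuous_drift hε₂).intervalIntegrable _ _)
      ((hx₁.continuous_drift hε₁).intervalIntegrable _ _) fun r hr => ?_
    refine regDrift_le_regDrift ha hε₁ hε (sub_nonpos.1 (hlast _ ?_ ?_).le)
    · rw [Real.lt_toNNReal_iff_coe_lt]; exact hr.1
    · rw [Real.toNNReal_le_iff_le_coe]; exact hr.2.le
  have h₁ := hx₁.eq_add_integral hε₁ s t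
  have h₂ := hx₂.eq_add_integral hε₂ s t
  linarith

/-- While the path is above the level `η` the drift is at most `a / η`. -/
lemma le_of_abs_le (hx : IsPrelimitPath x₀ a σ ε b x) (ha : 0 < a) (hσ : 0 < σ) (hε : 0 < ε)
    {η M : ℝ} (hη : 0 < η) {t : ℝ≥0} (hM : ∀ r ≤ t, |b r| ≤ M) :
    x t ≤ max (x₀ + σ * b 0) η + a / η * t + 2 * σ * M := by
  set c := max (x₀ + σ * b 0) η with hc
  have hcη : η ≤ c := le_max_right _ _
  have hM0 : 0 ≤ M := (abs_nonneg _).trans (hM t le_rfl)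
  by_contra! h
  have hpos : 0 ≤ a / η * t + 2 * σ * M := by positivity
  obtain ⟨s, hst, hs, hlast⟩ := exists_last_crossing (f := fun t => -x t) (c := -c) (r := 0)
    hx.continuous_path.neg t.2 (neg_le_neg (hx.apply_zero.trans_le (le_max_left _ _)))
    (neg_lt_neg (by linarith))
  have hint : ∫ r in (s : ℝ)..t, regDrift a ε (x r.toNNReal) ≤ ∫ r in (s : ℝ)..t, a / η := by
    refine intervalIntegral.integral_mono_on_of_le_Ioo (by exact_mod_cast hst.le)
      ((hx.continuous_drift hε).intervalIntegrable _ _) (by simp) fun r hr => ?_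
    have h1 : c < x r.toNNReal := by
      refine neg_lt_neg_iff.1 (hlast _ ?_ ?_)
      · rw [Real.lt_toNNReal_iff_coe_lt]; exact hr.1
      · rw [Real.toNNReal_le_iff_le_coe]; exact hr.2.le
    rw [regDrift_eq]
    gcongr
    exact (hcη.trans h1.le).trans ((le_max_left _ _).trans (by linarith))
  rw [intervalIntegral.integral_const, smul_eq_mul] at hint
  have h₁ := hx.eq_add_integral hε s t
  have h₂ : b t - b s ≤ 2 * M := by
    have := abs_le.1 (hM t le_rfl)
    have := abs_le.1 (hM s hst.le)
    linarith
  have h₃ : σ * (b t - b s) ≤ 2 * σ * M := by nlinarith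
  have h₄ : ((t : ℝ) - s) * (a / η) ≤ a / η * t := by
    have : 0 ≤ (s : ℝ) * (a / η) := by positivity
    linarith
  have hs' : x s = c := neg_injective hs
  linarith

/-- Either the path has been at the level `c` and has since lost at most `2m` to the noise, or it
has always been below `c`, where the drift is at least `a / (c + ε)`. -/
lemma min_le_of_abs_le (hx : IsPrelimitPath x₀ a σ ε b x) (ha : 0 < a) (hε : 0 < ε)
    {c m : ℝ} (hc : 0 < c) {t : ℝ≥0} (hm : ∀ r ≤ t, |σ * b r| ≤ m) :
    min (c - 2 * m) (x₀ - m + a / (c + ε) * t) ≤ x t := by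
  have hm0 : 0 ≤ m := (abs_nonneg _).trans (hm t le_rfl)
  have hbt := abs_le.1 (hm t le_rfl)
  rcases le_or_gt c (x t) with hct | hct
  · exact (min_le_left _ _).trans (by linarith)
  by_cases hr : ∃ r ≤ t, c ≤ x r
  · obtain ⟨r, hrt, hr⟩ := hr
    obtain ⟨s, hst, hs, -⟩ := exists_last_crossing hx.continuous_path hrt hr hct
    have h₁ := hx.eq_add_integral hε s t
    have h₂ := abs_le.1 (hm s hst.le)
    have h₃ : 0 ≤ ∫ r in (s : ℝ)..t, regDrift a ε (x r.toNNReal) :=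
      intervalIntegral.integral_nonneg (by exact_mod_cast hst.le)
        fun r _ => regDrift_nonneg ha hε _
    exact (min_le_left _ _).trans (by linarith)
  · push Not at hr
    have hint : ∫ r in (0 : ℝ)..t, a / (c + ε)
        ≤ ∫ r in (0 : ℝ)..t, regDrift a ε (x r.toNNReal) := by
      refine intervalIntegral.integral_mono_on t.2 (by simp)
        ((hx.continuous_drift hε).intervalIntegrable _ _) fun r h => ?_
      have h1 : x r.toNNReal < c := hr _ (by rw [Real.toNNReal_le_iff_le_coe]; exact h.2)
      have h2 : max (x r.toNNReal) 0 ≤ c := max_le h1.le hc.le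
      have h3 := le_max_right (x r.toNNReal) 0
      rw [regDrift_eq]
      gcongr
    rw [intervalIntegral.integral_const, smul_eq_mul, sub_zero, mul_comm] at hint
    have h₁ := hx.integral_eq t
    exact (min_le_right _ _).trans (by linarith)

end IsPrelimitPath

/-! ### The limit path -/

section Limit

variable {x₀ a σ : ℝ} {b : ℝ≥0 → ℝ}

lemma antitoneOn_prelimit (ha : 0 < a) (hb : Continuous b) (t : ℝ≥0) :
    AntitoneOn (fun ε => prelimit x₀ a σ ε b t) (Ioi 0) := fun _ h₁ _ h₂ h =>
  (isPrelimitPath_prelimit x₀ σ ha h₁ hb).le_of_le (isPrelimitPath_prelimit x₀ σ ha h₂ hb) ha h₁ h t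

lemma tendsto_prelimit (ha : 0 < a) (hσ : 0 < σ) (hb : Continuous b) (t : ℝ≥0) :
    Tendsto (fun ε => prelimit x₀ a σ ε b t) (𝓝[>] (0 : ℝ)) (𝓝 (roughBessel x₀ a σ b t)) := by
  obtain ⟨M, hM⟩ := isCompact_Icc.exists_bound_of_continuousOn (s := Icc 0 t) hb.continuousOn
  have hbdd : BddAbove ((fun ε => prelimit x₀ a σ ε b t) '' Ioi 0) := by
    refine ⟨max (x₀ + σ * b 0) 1 + a / 1 * t + 2 * σ * M, ?_⟩
    rintro _ ⟨ε, hε, rfl⟩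
    exact (isPrelimitPath_prelimit x₀ σ ha hε hb).le_of_abs_le ha hσ hε one_pos
      fun r hr => hM r ⟨r.2, hr⟩
  exact tendsto_nhds_limUnder ⟨_, (antitoneOn_prelimit ha hb t).tendsto_nhdsGT hbdd⟩

lemma prelimit_le_roughBessel (ha : 0 < a) (hσ : 0 < σ) (hb : Continuous b) {ε : ℝ} (hε : 0 < ε)
    (t : ℝ≥0) : prelimit x₀ a σ ε b t ≤ roughBessel x₀ a σ b t := by
  refine ge_of_tendsto (tendsto_prelimit ha hσ hb t) ?_
  filter_upwards [Ioo_mem_nhdsGT hε] with δ hδ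
  exact antitoneOn_prelimit ha hb t hδ.1 hε hδ.2.le

lemma roughBessel_le_of_abs_le (ha : 0 < a) (hσ : 0 < σ) (hb : Continuous b) {η M : ℝ}
    (hη : 0 < η) {t : ℝ≥0} (hM : ∀ r ≤ t, |b r| ≤ M) :
    roughBessel x₀ a σ b t ≤ max (x₀ + σ * b 0) η + a / η * t + 2 * σ * M := by
  refine le_of_tendsto (tendsto_prelimit ha hσ hb t) ?_
  filter_upwards [self_mem_nhdsWithin] with ε hε
  exact (isPrelimitPath_prelimit x₀ σ ha hε hb).le_of_abs_le ha hσ hε hη hM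

lemma tendsto_one_div_nat_nhdsGT :
    Tendsto (fun n : ℕ => 1 / ((n : ℝ) + 1)) atTop (𝓝[>] (0 : ℝ)) :=
  tendsto_nhdsWithin_iff.2 ⟨tendsto_one_div_add_atTop_nhds_zero_nat,
    Eventually.of_forall fun n => by simp only [mem_Ioi]; positivity⟩

lemma measurable_roughBessel (ha : 0 < a) (hσ : 0 < σ) (hb : Continuous b) :
    Measurable fun r : ℝ => roughBessel x₀ a σ b r.toNNReal := by
  refine measurable_of_tendsto_metrizable
    (f := fun (n : ℕ) (r : ℝ) => prelimit x₀ a σ (1 / ((n : ℝ) + 1)) b r.toNNReal)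
    (fun n => ?_) (tendsto_pi_nhds.2 fun r =>
      (tendsto_prelimit ha hσ hb _).comp tendsto_one_div_nat_nhdsGT)
  exact ((isPrelimitPath_prelimit x₀ σ ha (by positivity) hb).continuous_path.comp
    continuous_real_toNNReal).measurable

/-- Fatou's lemma for the regularised drifts. Their integrals stay bounded because the prelimit
paths do. -/
lemma lintegral_liminf_regDrift_lt_top (ha : 0 < a) (hσ : 0 < σ) (hb : Continuous b) (T : ℝ≥0) :
    ∫⁻ r in Ioc (0 : ℝ) T, liminf (fun n : ℕ => ENNReal.ofReal
      (regDrift a (1 / ((n : ℝ) + 1)) (prelimit x₀ a σ (1 / ((n : ℝ) + 1)) b r.toNNReal))) atTop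
      < ⊤ := by
  have hpre := fun n : ℕ =>
    isPrelimitPath_prelimit x₀ σ ha (ε := 1 / ((n : ℝ) + 1)) (by positivity) hb
  have hcont := fun n : ℕ => (hpre n).continuous_drift (by positivity)
  refine (lintegral_liminf_le fun n => (hcont n).measurable.ennreal_ofReal).trans_lt ?_
  refine lt_of_le_of_lt (liminf_le_of_frequently_le' (Frequently.of_forall fun n => ?_))
    (ENNReal.ofReal_lt_top (r := roughBessel x₀ a σ b T - x₀ - σ * b T))
  rw [← ofReal_integral_eq_lintegral_ofReal
    (((hcont n).integrableOn_Icc (a := 0) (b := (T : ℝ))).mono_set Ioc_subset_Icc_self)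
    (Eventually.of_forall fun r : ℝ => regDrift_nonneg ha (by positivity) _),
    ← intervalIntegral.integral_of_le T.coe_nonneg]
  refine ENNReal.ofReal_le_ofReal ?_
  have h₁ := (hpre n).integral_eq T
  have h₂ := prelimit_le_roughBessel (x₀ := x₀) ha hσ hb (ε := 1 / ((n : ℝ) + 1))
    (by positivity) T
  linarith

lemma tendsto_regDrift_prelimit (ha : 0 < a) (hσ : 0 < σ) (hb : Continuous b) (t : ℝ≥0)
    (h : 0 < roughBessel x₀ a σ b t) :
    Tendsto (fun ε => regDrift a ε (prelimit x₀ a σ ε b t)) (𝓝[>] 0)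
      (𝓝 (a / roughBessel x₀ a σ b t)) := by
  have hmax : max (roughBessel x₀ a σ b t) 0 + 0 = roughBessel x₀ a σ b t := by
    rw [add_zero, max_eq_left h.le]
  simp_rw [regDrift_eq]
  have h1 : Tendsto (fun ε => max (prelimit x₀ a σ ε b t) 0 + ε) (𝓝[>] 0)
      (𝓝 (max (roughBessel x₀ a σ b t) 0 + 0)) :=
    ((tendsto_prelimit ha hσ hb t).max tendsto_const_nhds).add
      (tendsto_id.mono_left nhdsWithin_le_nhds)
  rw [hmax] at h1
  exact tendsto_const_nhds.div h1 h.ne'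

lemma ae_restrict_roughBessel_pos (ha : 0 < a) (hσ : 0 < σ) (hb : Continuous b) (T : ℝ≥0) :
    ∀ᵐ r ∂volume.restrict (Ioc (0 : ℝ) T), 0 < roughBessel x₀ a σ b r.toNNReal := by
  have hpre := fun n : ℕ =>
    isPrelimitPath_prelimit x₀ σ ha (ε := 1 / ((n : ℝ) + 1)) (by positivity) hb
  have hmeas : Measurable fun r : ℝ => liminf (fun n : ℕ => ENNReal.ofReal
      (regDrift a (1 / ((n : ℝ) + 1))
        (prelimit x₀ a σ (1 / ((n : ℝ) + 1)) b r.toNNReal))) atTop :=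
    Measurable.liminf fun n => ((hpre n).continuous_drift (by positivity)).measurable.ennreal_ofReal
  filter_upwards [ae_lt_top hmeas (lintegral_liminf_regDrift_lt_top ha hσ hb T).ne] with r hr
  by_contra! hneg
  -- All prelimit paths are then nonpositive at this time, so their drifts `a / ε` diverge.
  refine hr.ne (Tendsto.liminf_eq ?_)
  have hdrift : ∀ n : ℕ, regDrift a (1 / ((n : ℝ) + 1))
      (prelimit x₀ a σ (1 / ((n : ℝ) + 1)) b r.toNNReal) = a * ((n : ℝ) + 1) := fun n => by
    have := prelimit_le_roughBessel (x₀ := x₀) ha hσ hb (ε := 1 / ((n : ℝ) + 1))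
      (by positivity) r.toNNReal
    rw [regDrift_eq, max_eq_right (this.trans hneg)]
    field_simp
    ring
  simp_rw [hdrift]
  exact ENNReal.tendsto_ofReal_atTop.comp ((tendsto_atTop_add_const_right _ 1
    tendsto_natCast_atTop_atTop).const_mul_atTop ha)

lemma ae_roughBessel_pos (ha : 0 < a) (hσ : 0 < σ) (hb : Continuous b) :
    ∀ᵐ t : ℝ, 0 ≤ t → 0 < roughBessel x₀ a σ b t.toNNReal := by
  have h : ∀ᵐ t : ℝ, ∀ n : ℕ, t ∈ Ioc (0 : ℝ) (n : ℝ≥0) →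
      0 < roughBessel x₀ a σ b t.toNNReal := ae_all_iff.2 fun n =>
    (ae_restrict_iff' measurableSet_Ioc).1 (ae_restrict_roughBessel_pos ha hσ hb n)
  filter_upwards [h, Measure.ae_ne volume (0 : ℝ)] with t ht ht0 h0
  obtain ⟨n, hn⟩ := exists_nat_ge t
  exact ht n ⟨lt_of_le_of_ne h0 ht0.symm, by simpa using hn⟩

lemma intervalIntegrable_one_div_roughBessel (ha : 0 < a) (hσ : 0 < σ) (hb : Continuous b)
    (T : ℝ≥0) :
    IntervalIntegrable (fun t : ℝ => 1 / roughBessel x₀ a σ b t.toNNReal) volume 0 T := by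
  rw [intervalIntegrable_iff_integrableOn_Ioc_of_le T.coe_nonneg]
  suffices h : IntegrableOn (fun t : ℝ => a / roughBessel x₀ a σ b t.toNNReal) (Ioc 0 T) by
    refine (h.const_mul a⁻¹).congr (Eventually.of_forall fun t => ?_)
    simp only
    field_simp
  refine ⟨((measurable_roughBessel ha hσ hb).const_div a).aestronglyMeasurable, ?_⟩
  refine lt_of_le_of_lt (lintegral_mono_ae ?_)
    (lintegral_liminf_regDrift_lt_top (x₀ := x₀) ha hσ hb T)
  filter_upwards [ae_restrict_roughBessel_pos (x₀ := x₀) ha hσ hb T] with r hr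
  refine le_of_eq ?_
  rw [Real.enorm_of_nonneg (by positivity)]
  exact (((ENNReal.continuous_ofReal.tendsto _).comp (tendsto_regDrift_prelimit ha hσ hb _ hr)).comp
    tendsto_one_div_nat_nhdsGT).liminf_eq.symm

lemma div_le_integral_one_div_roughBessel (ha : 0 < a) (hσ : 0 < σ) (hb : Continuous b) {K : ℝ}
    {T : ℝ≥0} (hK : ∀ r ≤ T, roughBessel x₀ a σ b r ≤ K) :
    T / K ≤ ∫ t in (0 : ℝ)..T, 1 / roughBessel x₀ a σ b t.toNNReal := by
  calc (T : ℝ) / K = ∫ _ in (0 : ℝ)..T, 1 / K := by simp [div_eq_mul_inv]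
    _ ≤ _ := by
      refine intervalIntegral.integral_mono_ae_restrict T.2 (by simp)
        (intervalIntegrable_one_div_roughBessel ha hσ hb T) ?_
      filter_upwards [ae_restrict_mem measurableSet_Icc,
        ae_restrict_of_ae (ae_roughBessel_pos ha hσ hb)] with t ht hpos
      have := hpos ht.1
      refine one_div_le_one_div_of_le this (hK _ ?_)
      rw [Real.toNNReal_le_iff_le_coe]; exact ht.2

/-- Over a period in which a prelimit path is at least `1` no mass is lost in the limit, and the
limit path solves the singular equation. -/
lemma roughBessel_eq_add_integral (ha : 0 < a) (hσ : 0 < σ) (hb : Continuous b) {s t : ℝ≥0}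
    (hst : s ≤ t) (h1 : ∀ r, s ≤ r → 1 ≤ prelimit x₀ a σ 1 b r) :
    roughBessel x₀ a σ b t = roughBessel x₀ a σ b s
      + a * (∫ r in (s : ℝ)..t, 1 / roughBessel x₀ a σ b r.toNNReal) + σ * (b t - b s) := by
  have hlim : Tendsto (fun ε => ∫ r in (s : ℝ)..t, regDrift a ε (prelimit x₀ a σ ε b r.toNNReal))
      (𝓝[>] 0) (𝓝 (∫ r in (s : ℝ)..t, a / roughBessel x₀ a σ b r.toNNReal)) := by
    have hs : ∀ r ∈ uIoc (s : ℝ) t, s ≤ r.toNNReal := fun r hr => by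
      rw [uIoc_of_le (by exact_mod_cast hst)] at hr
      exact NNReal.le_toNNReal_of_coe_le hr.1.le
    refine intervalIntegral.tendsto_integral_filter_of_dominated_convergence (fun _ => a)
      ?_ ?_ (by simp) ?_
    · filter_upwards [self_mem_nhdsWithin] with ε hε
      exact ((isPrelimitPath_prelimit x₀ σ ha hε hb).continuous_drift hε).aestronglyMeasurable
    · filter_upwards [Ioo_mem_nhdsGT one_pos] with ε hε
      refine Eventually.of_forall fun r hr => ?_
      have h2 : 1 ≤ prelimit x₀ a σ ε b r.toNNReal :=
        (h1 _ (hs r hr)).trans (antitoneOn_prelimit ha hb _ hε.1 (mem_Ioi.2 one_pos) hε.2.le)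
      rw [Real.norm_of_nonneg (regDrift_nonneg ha hε.1 _), regDrift_eq]
      refine div_le_self ha.le ?_
      have := le_max_left (prelimit x₀ a σ ε b r.toNNReal) 0
      linarith [hε.1]
    · refine Eventually.of_forall fun r hr => tendsto_regDrift_prelimit ha hσ hb _ ?_
      exact one_pos.trans_le ((h1 _ (hs r hr)).trans (prelimit_le_roughBessel ha hσ hb one_pos _))
  have hsum := ((tendsto_prelimit (x₀ := x₀) ha hσ hb s).add hlim).add_const (σ * (b t - b s))
  refine (tendsto_nhds_unique_of_eventuallyEq (tendsto_prelimit ha hσ hb t) hsum ?_).trans ?_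
  · filter_upwards [self_mem_nhdsWithin] with ε hε
    exact (isPrelimitPath_prelimit x₀ σ ha hε hb).eq_add_integral hε s t
  · rw [← intervalIntegral.integral_const_mul]
    simp_rw [mul_one_div]

end Limit

/-! ### Consistency for a driving path of small growth -/

section Consistency

variable {x₀ a σ : ℝ} {b : ℝ≥0 → ℝ} {C γ : ℝ}

lemma tendsto_add_one_rpow_sub_half (hγ : γ < 1 / 2) :
    Tendsto (fun t : ℝ≥0 => ((t : ℝ) + 1) ^ (γ - 1 / 2)) atTop (𝓝 0) := by
  have h : γ - 1 / 2 = -(1 / 2 - γ) := by ring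
  rw [h]
  exact (tendsto_rpow_neg_atTop (by linarith)).comp
    (tendsto_atTop_add_const_right _ _ (NNReal.tendsto_coe_atTop.2 tendsto_id))

lemma rpow_eq_sqrt_mul (t : ℝ≥0) :
    ((t : ℝ) + 1) ^ γ = ((t : ℝ) + 1) ^ (γ - 1 / 2) * √((t : ℝ) + 1) := by
  rw [Real.sqrt_eq_rpow, ← Real.rpow_add (by positivity)]
  congr 1
  ring

lemma abs_le_of_growth (hγ0 : 0 ≤ γ) (hC : ∀ t, |b t| ≤ C * ((t : ℝ) + 1) ^ γ) (t : ℝ≥0) :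
    ∀ r ≤ t, |b r| ≤ C * ((t : ℝ) + 1) ^ γ := by
  intro r hr
  have hC0 : 0 ≤ C := by simpa using (abs_nonneg _).trans (hC 0)
  refine (hC r).trans ?_
  gcongr

/-- In the bound at level `η`, the choice `η = √(t + 1)` balances the two terms. -/
lemma exists_roughBessel_le_mul_sqrt (hx₀ : 0 < x₀) (ha : 0 < a) (hσ : 0 < σ) (hb : Continuous b)
    (hγ0 : 0 ≤ γ) (hγ : γ < 1 / 2) (hC : ∀ t, |b t| ≤ C * ((t : ℝ) + 1) ^ γ) :
    ∃ K, 0 < K ∧ ∀ t r : ℝ≥0, r ≤ t → roughBessel x₀ a σ b r ≤ K * √((t : ℝ) + 1) := by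
  have hC0 : 0 ≤ C := by simpa using (abs_nonneg _).trans (hC 0)
  refine ⟨x₀ + σ * C + 1 + a + 2 * σ * C, by positivity, fun t r hr => ?_⟩
  suffices h : ∀ t : ℝ≥0, roughBessel x₀ a σ b t
      ≤ (x₀ + σ * C + 1 + a + 2 * σ * C) * √((t : ℝ) + 1) by
    refine (h r).trans ?_
    gcongr
  intro t
  have hs1 : 1 ≤ √((t : ℝ) + 1) := Real.one_le_sqrt.2 (by simp)
  have hM : C * ((t : ℝ) + 1) ^ γ ≤ C * √((t : ℝ) + 1) := by
    rw [Real.sqrt_eq_rpow]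
    gcongr
    simp
  have hmain := roughBessel_le_of_abs_le (x₀ := x₀) ha hσ hb (η := √((t : ℝ) + 1))
    (one_pos.trans_le hs1) (abs_le_of_growth hγ0 hC t)
  have hsq : √((t : ℝ) + 1) * √((t : ℝ) + 1) = t + 1 := Real.mul_self_sqrt (by positivity)
  set h := √((t : ℝ) + 1)
  have h1 : max (x₀ + σ * b 0) h ≤ (x₀ + σ * C + 1) * h := by
    have hb0 : b 0 ≤ C := by simpa using (le_abs_self _).trans (hC 0)
    have h2 : σ * b 0 ≤ σ * C := by gcongr
    have h3 : 0 ≤ σ * C := by positivity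
    refine max_le ?_ ?_ <;> nlinarith
  have h2 : a / h * t ≤ a * h := by
    rw [div_mul_eq_mul_div, div_le_iff₀ (by linarith), mul_assoc, hsq]
    gcongr
    linarith
  have h3 : 2 * σ * (C * ((t : ℝ) + 1) ^ γ) ≤ 2 * σ * (C * h) := by gcongr
  linarith

/-- In the dichotomy at level `c`, the choice `c = √(a t / 2)` makes the drift push the path to the
level within the available time, while the noise is negligible. -/
lemma eventually_one_le_prelimit (hx₀ : 0 < x₀) (ha : 0 < a) (hσ : 0 < σ) (hb : Continuous b)
    (hγ0 : 0 ≤ γ) (hγ : γ < 1 / 2) (hC : ∀ t, |b t| ≤ C * ((t : ℝ) + 1) ^ γ) :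
    ∀ᶠ t : ℝ≥0 in atTop, 1 ≤ prelimit x₀ a σ 1 b t := by
  have hlim : Tendsto (fun t : ℝ≥0 => σ * C * ((t : ℝ) + 1) ^ (γ - 1 / 2)) atTop (𝓝 0) := by
    simpa using (tendsto_add_one_rpow_sub_half hγ).const_mul (σ * C)
  have hsmall := hlim.eventually_le_const (show (0 : ℝ) < √(a / 4) / 4 by positivity)
  filter_upwards [hsmall, eventually_ge_atTop 1, eventually_ge_atTop (8 / a).toNNReal]
    with t ht ht1 hta
  have ht1' : (1 : ℝ) ≤ t := by exact_mod_cast ht1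
  have hta' : 8 ≤ a * t := by
    have := (Real.toNNReal_le_iff_le_coe.1 hta)
    rwa [div_le_iff₀ ha, mul_comm] at this
  set c := √(a * t / 2) with hc
  have hcsq : c * c = a * t / 2 := Real.mul_self_sqrt (by positivity)
  have hc2 : 2 ≤ c := Real.le_sqrt_of_sq_le (by linarith)
  have hm : ∀ r ≤ t, |σ * b r| ≤ c / 4 := by
    intro r hr
    rw [abs_mul, abs_of_pos hσ]
    calc σ * |b r| ≤ σ * (C * ((t : ℝ) + 1) ^ γ) := by
          gcongr
          exact abs_le_of_growth hγ0 hC t r hr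
      _ = σ * C * ((t : ℝ) + 1) ^ (γ - 1 / 2) * √((t : ℝ) + 1) := by
          rw [rpow_eq_sqrt_mul]; ring
      _ ≤ √(a / 4) / 4 * √((t : ℝ) + 1) := by gcongr
      _ = √(a / 4 * (t + 1)) / 4 := by rw [Real.sqrt_mul (by positivity)]; ring
      _ ≤ c / 4 := by
          rw [hc]
          gcongr
          nlinarith
  refine le_trans (le_min ?_ ?_) ((isPrelimitPath_prelimit x₀ σ ha one_pos hb).min_le_of_abs_le ha
    one_pos (c := c) (by linarith) hm)
  · linarith
  · have : c ≤ a / (c + 1) * t := by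
      rw [div_mul_eq_mul_div, le_div_iff₀ (by linarith)]
      nlinarith
    linarith

/-- Once the path stays positive, `X(T) = D + a ∫₀ᵀ dt / X(t) + σ b(T)` with a constant `D`, and the
integral is at least of order `√T`, which dominates `D + σ b(T)`. -/
theorem tendsto_driftEstimator_roughBessel (hx₀ : 0 < x₀) (ha : 0 < a) (hσ : 0 < σ)
    (hb : Continuous b) (hγ0 : 0 ≤ γ) (hγ : γ < 1 / 2)
    (hC : ∀ t, |b t| ≤ C * ((t : ℝ) + 1) ^ γ) :
    Tendsto (driftEstimator (roughBessel x₀ a σ b)) atTop (𝓝 a) := by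
  have hC0 : 0 ≤ C := by simpa using (abs_nonneg _).trans (hC 0)
  obtain ⟨K, hK0, hK⟩ := exists_roughBessel_le_mul_sqrt hx₀ ha hσ hb hγ0 hγ hC
  obtain ⟨T₀, hT₀⟩ := eventually_atTop.1 (eventually_one_le_prelimit hx₀ ha hσ hb hγ0 hγ hC)
  set X := roughBessel x₀ a σ b with hX
  set I : ℝ≥0 → ℝ := fun T => ∫ t in (0 : ℝ)..T, 1 / X t.toNNReal with hI
  have hint := fun T => intervalIntegrable_one_div_roughBessel (x₀ := x₀) ha hσ hb T
  set D : ℝ := X T₀ - a * I T₀ - σ * b T₀ with hD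
  have hXT : ∀ T, T₀ ≤ T → X T = D + σ * b T + a * I T := by
    intro T hT
    have h1 := roughBessel_eq_add_integral ha hσ hb hT hT₀
    have h2 : I T = I T₀ + ∫ t in (T₀ : ℝ)..T, 1 / X t.toNNReal :=
      (intervalIntegral.integral_add_adjacent_intervals (hint T₀)
        ((hint T₀).symm.trans (hint T))).symm
    rw [h2, hD]
    linarith
  have hbound : Tendsto (fun T : ℝ≥0 => 2 * K * (|D| + σ * C) * ((T : ℝ) + 1) ^ (γ - 1 / 2))
      atTop (𝓝 0) := by
    simpa using (tendsto_add_one_rpow_sub_half hγ).const_mul (2 * K * (|D| + σ * C))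
  rw [tendsto_iff_norm_sub_tendsto_zero]
  refine squeeze_zero' (Eventually.of_forall fun _ => norm_nonneg _) ?_ hbound
  filter_upwards [eventually_ge_atTop T₀, eventually_ge_atTop 1] with T hT hT1
  have hT1' : (1 : ℝ) ≤ T := by exact_mod_cast hT1
  have hIT : (T : ℝ) / (K * √((T : ℝ) + 1)) ≤ I T :=
    div_le_integral_one_div_roughBessel ha hσ hb (hK T)
  have hs : 0 < √((T : ℝ) + 1) := by positivity
  have hIpos : 0 < I T := lt_of_lt_of_le (by positivity) hIT
  have hest : driftEstimator X T - a = (D + σ * b T) / I T := by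
    change X T / I T - a = _
    rw [hXT T hT]
    field_simp
    ring
  have hone : 1 ≤ ((T : ℝ) + 1) ^ γ := Real.one_le_rpow (by linarith) hγ0
  have hnum : |D + σ * b T| ≤ (|D| + σ * C) * ((T : ℝ) + 1) ^ γ := by
    calc |D + σ * b T| ≤ |D| + σ * |b T| := by
          simpa [abs_mul, abs_of_pos hσ] using abs_add_le D (σ * b T)
      _ ≤ |D| * ((T : ℝ) + 1) ^ γ + σ * (C * ((T : ℝ) + 1) ^ γ) :=
          add_le_add (le_mul_of_one_le_right (abs_nonneg _) hone)
            (mul_le_mul_of_nonneg_left (hC T) hσ.le)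
      _ = _ := by ring
  rw [hest, Real.norm_eq_abs, abs_div, abs_of_pos hIpos, div_le_iff₀ hIpos]
  refine hnum.trans ?_
  have hsq : √((T : ℝ) + 1) * √((T : ℝ) + 1) = T + 1 := Real.mul_self_sqrt (by positivity)
  have hIs : √((T : ℝ) + 1) ≤ 2 * K * I T := by
    have h1 : √((T : ℝ) + 1) ≤ 2 * K * ((T : ℝ) / (K * √((T : ℝ) + 1))) := by
      have : 2 * K * ((T : ℝ) / (K * √((T : ℝ) + 1))) = 2 * T / √((T : ℝ) + 1) := by
        field_simp
      rw [this, le_div_iff₀ hs, hsq]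
      linarith
    exact h1.trans (by gcongr)
  calc (|D| + σ * C) * ((T : ℝ) + 1) ^ γ
      = (|D| + σ * C) * ((T : ℝ) + 1) ^ (γ - 1 / 2) * √((T : ℝ) + 1) := by
        rw [rpow_eq_sqrt_mul]; ring
    _ ≤ (|D| + σ * C) * ((T : ℝ) + 1) ^ (γ - 1 / 2) * (2 * K * I T) := by gcongr
    _ = _ := by ring

end Consistency

end RoughBessel

theorem mainTheorem4 {Ω : Type*} [MeasurableSpace Ω] (P : Measure Ω) [IsProbabilityMeasure P]
    (H : ℝ) (hH0 : 0 < H) (hH : H < 1 / 2)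
    (B : ℝ≥0 → Ω → ℝ) (hB : RoughBessel.IsFractionalBrownianMotion H B P)
    (x₀ a σ : ℝ) (hx₀ : 0 < x₀) (ha : 0 < a) (hσ : 0 < σ)
    (X : ℝ≥0 → Ω → ℝ)
    (hX : ∀ t ω, X t ω = RoughBessel.roughBessel x₀ a σ (fun s => B s ω) t) :
    ∀ᵐ ω ∂P,
      -- the limit defining the rough Bessel process exists and is finite
      (∀ t, Tendsto (fun ε => RoughBessel.prelimit x₀ a σ ε (fun s => B s ω) t)
        (𝓝[>] (0 : ℝ)) (𝓝 (X t ω))) ∧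
      -- the estimator is well defined
      (∀ᵐ t : ℝ, 0 ≤ t → 0 < X t.toNNReal ω) ∧
      (∀ T : ℝ≥0, 0 < T →
        IntervalIntegrable (fun t : ℝ => 1 / X t.toNNReal ω) volume 0 T ∧
        0 < ∫ t in (0 : ℝ)..T, 1 / X t.toNNReal ω) ∧
      -- strong consistency
      Tendsto (RoughBessel.driftEstimator fun t => X t ω) atTop (𝓝 a) := by
  -- The exponent `H + 1 / q` has to stay below `1 / 2`.
  obtain ⟨q, hq⟩ := exists_nat_gt (max (3 / H) (1 / (1 / 2 - H)))
  have hq1 : 3 / H < q := (le_max_left _ _).trans_lt hq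
  have hq2 : 1 / (1 / 2 - H) < q := (le_max_right _ _).trans_lt hq
  have hq3 : 3 ≤ q * H := ((div_lt_iff₀ hH0).1 hq1).le
  have hq0 : (0 : ℝ) < q := lt_trans (by positivity) hq1
  have hγ : H + 1 / q < 1 / 2 := by
    have := (one_div_lt (by linarith) hq0).1 hq2
    linarith
  have hγ0 : 0 ≤ H + 1 / q := by positivity
  filter_upwards [hB.continuous_paths, hB.ae_growth hH0 hq3] with ω hb ⟨C, hC⟩
  simp only [hX]
  refine ⟨RoughBessel.tendsto_prelimit ha hσ hb, RoughBessel.ae_roughBessel_pos ha hσ hb,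
    fun T hT => ⟨RoughBessel.intervalIntegrable_one_div_roughBessel ha hσ hb T, ?_⟩,
    RoughBessel.tendsto_driftEstimator_roughBessel hx₀ ha hσ hb hγ0 hγ hC⟩
  obtain ⟨K, hK0, hK⟩ :=
    RoughBessel.exists_roughBessel_le_mul_sqrt hx₀ ha hσ hb hγ0 hγ hC
  have hT' : (0 : ℝ) < T := by exact_mod_cast hT
  exact lt_of_lt_of_le (by positivity)
    (RoughBessel.div_le_integral_one_div_roughBessel ha hσ hb (hK T))
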